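/- Let $d\ge 1$ and let $\Omega\subset\mathbb{R}^d$ be a bounded open set. Let $A^\varepsilon\in (L^\infty(\Omega))^{d\times d}$ (not necessarily symmetric) be elliptic: there are $0<\alpha_1\le\alpha_2$ such that, for every $\xi\in\mathbb{R}^d$, $\alpha_1|\xi|^2\le (A^\varepsilon(x)\xi)\cdot\xi\le\alpha_2|\xi|^2$ for a.e. $x\in\Omega$. Let $b\in(L^\infty(\Omega))^d$ with $\operatorname{div} b=0$ in $\Omega$ (in the sense of distributions), $f\in L^2(\Omega)$ and $\alpha_{\rm spl}>0$. Write $|v|_{H^1(\Omega)}=\|\nabla v\|_{L^2(\Omega)}$, and let $\|\cdot\|_{L^\infty(\Omega)}$ be the essential supremum of the Euclidean norm (for vector fields) or of the operator norm induced by the Euclidean norm (for matrix fields). Let $u^\varepsilon\in H^1_0(\Omega)$ denote the weak solution to $$-\operatorname{div}(A^\varepsilon\nabla u^\varepsilon)+b\cdot\nabla u^\varepsilon=f\ \text{ in }\Omega,\qquad u^\varepsilon=0\ \text{ on }\partial\Omega.$$ For $\beta\ge 0$ and arbitrary initial data $u_0,u_1\in H^1_0(\Omega)$, the damped splitting scheme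 defines $u_{2n+2},u_{2n+3}\in H^1_0(\Omega)$, $n\ge 0$, as the weak solutions to $$-(\beta+\alpha_{\rm spl})\Delta u_{2n+2}+b\cdot\nabla u_{2n+2}=f+b\cdot\nabla(u_{2n}-u_{2n+1})-\beta\Delta u_{2n+1}\ \text{ in }\Omega,\qquad u_{2n+2}=0\ \text{ on }\partial\Omega,$$ $$-\operatorname{div}\big((\beta\,\mathrm{Id}+A^\varepsilon)\nabla u_{2n+3}\big)=-(\beta+\alpha_{\rm spl})\Delta u_{2n+2}\ \text{ in }\Omega,\qquad u_{2n+3}=0\ \text{ on }\partial\Omega.$$ Lemma. The solution $u^\varepsilon$ exists and is unique, and there is a Poincaré constant, i.e. a $C_\Omega\ge 0$ with $\|\varphi\|_{L^2(\Omega)}\le C_\Omega|\varphi|_{H^1(\Omega)}$ for all $\varphi\in H^1_0(\Omega)$. For every such $C_\Omega$, the function $$g(x)=\frac{C_\Omega\|b\|_{L^\infty(\Omega)}}{x+\alpha_{\rm spl}}\,\frac{\|A^\varepsilon-\alpha_{\rm spl}\mathrm{Id}\|_{L^\infty(\Omega)}}{x+\alpha_1}+\frac{x}{x+\alpha_1},\qquad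 x\ge 0,$$ has a unique minimizer $\beta$ over $[0,\infty)$. For this $\beta$: 1. $g(\beta)<1$; 2. for all $u_0,u_1\in H^1_0(\Omega)$ the scheme defines a unique sequence $(u_n)_{n\ge 0}$ in $H^1_0(\Omega)$; 3. $|u_{2n+4}-u_{2n+2}|_{H^1(\Omega)}\le g(\beta)\,|u_{2n+2}-u_{2n}|_{H^1(\Omega)}$ for all $n\ge 1$, and also for $n=0$ if $-\operatorname{div}((\beta\,\mathrm{Id}+A^\varepsilon)\nabla u_1)=-(\beta+\alpha_{\rm spl})\Delta u_0$ weakly in $\Omega$ (for instance if $u_0=u_1=0$); 4. $u_{2n+1}\to u^\varepsilon$ in $H^1_0(\Omega)$ (that is, in the $H^1$ norm) as $n\to\infty$. -/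

import Mathlib

open MeasureTheory Filter Topology
open scoped ContDiff

namespace DampedSplitting

noncomputable section

/-- Euclidean space `ℝᵈ`. -/
abbrev E (d : ℕ) : Type := EuclideanSpace ℝ (Fin d)

/-- `φ ∈ C_c^∞(Ω)`: smooth, with compact support contained in `Ω`. -/
def IsTestFunction {d : ℕ} (Ω : Set (E d)) (φ : E d → ℝ) : Prop :=
  ContDiff ℝ ∞ φ ∧ HasCompactSupport φ ∧ tsupport φ ⊆ Ω

/-- The Hilbert space `L²(Ω) × L²(Ω; ℝᵈ)` with the norm `(‖u‖² + ‖G‖²)^{1/2}`; for `G = ∇u` this is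
the `H¹(Ω)` norm of `u`. -/
abbrev L2Pair {d : ℕ} (Ω : Set (E d)) : Type :=
  WithLp 2 (Lp ℝ 2 (volume.restrict Ω) × Lp (E d) 2 (volume.restrict Ω))

/-- The copy of `C_c^∞(Ω)` in `L²(Ω) × L²(Ω; ℝᵈ)` consisting of the pairs `(φ, ∇φ)`. -/
def testPairs {d : ℕ} (Ω : Set (E d)) : Submodule ℝ (L2Pair Ω) where
  carrier := {p | ∃ φ : E d → ℝ, IsTestFunction Ω φ ∧
    p.fst =ᵐ[volume.restrict Ω] φ ∧ p.snd =ᵐ[volume.restrict Ω] gradient φ}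
  zero_mem' := by
    refine ⟨fun _ => 0, ⟨contDiff_const, HasCompactSupport.zero, by simp [tsupport]⟩, ?_, ?_⟩
    · exact Lp.coeFn_zero _ _ _
    · refine (Lp.coeFn_zero (E d) 2 (volume.restrict Ω)).trans (Eventually.of_forall fun x => ?_)
      simp [gradient]
  add_mem' := by
    rintro p q ⟨φ, ⟨hφ, hφc, hφΩ⟩, hp1, hp2⟩ ⟨ψ, ⟨hψ, hψc, hψΩ⟩, hq1, hq2⟩
    refine ⟨φ + ψ, ⟨hφ.add hψ, hφc.add hψc,
      (tsupport_add φ ψ).trans (Set.union_subset hφΩ hψΩ)⟩, ?_, ?_⟩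
    · exact (Lp.coeFn_add p.fst q.fst).trans (hp1.add hq1)
    · refine ((Lp.coeFn_add p.snd q.snd).trans (hp2.add hq2)).trans (Eventually.of_forall fun x => ?_)
      have h1 : DifferentiableAt ℝ φ x := (hφ.differentiable (by simp)) x
      have h2 : DifferentiableAt ℝ ψ x := (hψ.differentiable (by simp)) x
      simp [gradient, fderiv_add h1 h2]
  smul_mem' := by
    rintro c p ⟨φ, ⟨hφ, hφc, hφΩ⟩, hp1, hp2⟩
    refine ⟨c • φ, ⟨hφ.const_smul c, hφc.smul_left (f := fun _ => c),
      (tsupport_smul_subset_right (fun _ => c) φ).trans hφΩ⟩, ?_, ?_⟩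
    · exact (Lp.coeFn_smul c p.fst).trans (hp1.const_smul c)
    · refine ((Lp.coeFn_smul c p.snd).trans (hp2.const_smul c)).trans
        (Eventually.of_forall fun x => ?_)
      have h1 : DifferentiableAt ℝ φ x := (hφ.differentiable (by simp)) x
      simp [gradient, fderiv_const_smul h1 c]

/-- The Sobolev space `H¹₀(Ω)`: the closure of `C_c^∞(Ω)` for the `H¹` norm. A function `u ∈ H¹₀(Ω)`
is represented by the pair `(u, ∇u)`; as a closed subspace of `L²(Ω) × L²(Ω; ℝᵈ)` it carries the
`H¹` norm. -/
def H10 {d : ℕ} (Ω : Set (E d)) : Submodule ℝ (L2Pair Ω) := (testPairs Ω).topologicalClosure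

/-- The function underlying an element of `H¹₀(Ω)`. -/
def fn {d : ℕ} {Ω : Set (E d)} (u : H10 Ω) : Lp ℝ 2 (volume.restrict Ω) := (u : L2Pair Ω).fst

/-- The (weak) gradient of an element of `H¹₀(Ω)`. -/
def grad {d : ℕ} {Ω : Set (E d)} (u : H10 Ω) : Lp (E d) 2 (volume.restrict Ω) :=
  (u : L2Pair Ω).snd

/-- `C` is a Poincaré constant of `Ω`: `‖φ‖_{L²(Ω)} ≤ C |φ|_{H¹(Ω)}` on `H¹₀(Ω)`, where
`|φ|_{H¹(Ω)} = ‖∇φ‖_{L²(Ω)}`. -/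
def IsPoincareConstant {d : ℕ} (Ω : Set (E d)) (C : ℝ) : Prop :=
  0 ≤ C ∧ ∀ φ : H10 Ω, ‖fn φ‖ ≤ C * ‖grad φ‖

/-- `div b = 0` in `Ω` in the sense of distributions. -/
def IsDivFree {d : ℕ} (Ω : Set (E d)) (b : E d → E d) : Prop :=
  ∀ φ : E d → ℝ, IsTestFunction Ω φ → ∫ x in Ω, inner ℝ (b x) (gradient φ x) = 0

/-- The matrix `M` as a linear operator of Euclidean space (in particular its norm is the operator
norm induced by the Euclidean norm). -/
def op {d : ℕ} (M : Matrix (Fin d) (Fin d) ℝ) : E d →L[ℝ] E d := Matrix.toEuclideanCLM (𝕜 := ℝ) M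

/-- Ellipticity of the matrix field `A` in `Ω`: `α₁ |ξ|² ≤ (A(x) ξ) · ξ ≤ α₂ |ξ|²`. -/
def IsElliptic {d : ℕ} (Ω : Set (E d)) (A : E d → Matrix (Fin d) (Fin d) ℝ) (α₁ α₂ : ℝ) : Prop :=
  ∀ ξ : E d, ∀ᵐ x ∂(volume.restrict Ω),
    α₁ * ‖ξ‖ ^ 2 ≤ inner ℝ (op (A x) ξ) ξ ∧ inner ℝ (op (A x) ξ) ξ ≤ α₂ * ‖ξ‖ ^ 2

/-- The `L^∞(Ω)` norm of a vector-valued function. -/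
def supNorm {d : ℕ} (Ω : Set (E d)) {F : Type*} [NormedAddCommGroup F] (h : E d → F) : ℝ :=
  (eLpNorm h ⊤ (volume.restrict Ω)).toReal

/-- `(u, v) ↦ ∫_Ω ∇u · ∇v`. -/
def dirichlet {d : ℕ} {Ω : Set (E d)} (u v : H10 Ω) : ℝ :=
  ∫ x in Ω, inner ℝ (grad u x) (grad v x)

/-- `(u, v) ↦ ∫_Ω (A ∇u) · ∇v`. -/
def diffusion {d : ℕ} {Ω : Set (E d)} (A : E d → Matrix (Fin d) (Fin d) ℝ) (u v : H10 Ω) : ℝ :=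
  ∫ x in Ω, inner ℝ (op (A x) (grad u x)) (grad v x)

/-- `(u, v) ↦ ∫_Ω (b · ∇u) v`. -/
def convection {d : ℕ} {Ω : Set (E d)} (b : E d → E d) (u v : H10 Ω) : ℝ :=
  ∫ x in Ω, inner ℝ (b x) (grad u x) * fn v x

/-- `v ↦ ∫_Ω f v`. -/
def load {d : ℕ} {Ω : Set (E d)} (f : E d → ℝ) (v : H10 Ω) : ℝ :=
  ∫ x in Ω, f x * fn v x

/-- `u ∈ H¹₀(Ω)` is the weak solution to `-div (A ∇u) + b · ∇u = f` in `Ω`, `u = 0` on `∂Ω`. -/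
def IsWeakSolution {d : ℕ} {Ω : Set (E d)} (A : E d → Matrix (Fin d) (Fin d) ℝ) (b : E d → E d)
    (f : E d → ℝ) (u : H10 Ω) : Prop :=
  ∀ v : H10 Ω, diffusion A u v + convection b u v = load f v

/-- The first step of the damped scheme, giving `w = u_{2n+2}` from `p = u_{2n}`, `q = u_{2n+1}`:
`-(β + αspl) Δw + b · ∇w = f + b · ∇(p - q) - β Δq` in `Ω`, `w = 0` on `∂Ω`, in weak form. -/
def IsConvectionStep {d : ℕ} {Ω : Set (E d)} (b : E d → E d) (f : E d → ℝ) (αspl β : ℝ)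
    (p q w : H10 Ω) : Prop :=
  ∀ v : H10 Ω, (β + αspl) * dirichlet w v + convection b w v =
    load f v + convection b (p - q) v + β * dirichlet q v

/-- The second step of the damped scheme, giving `z = u_{2n+3}` from `w = u_{2n+2}`:
`-div ((β Id + A) ∇z) = -(β + αspl) Δw` in `Ω`, `z = 0` on `∂Ω`, in weak form. -/
def IsDiffusionStep {d : ℕ} {Ω : Set (E d)} (A : E d → Matrix (Fin d) (Fin d) ℝ) (αspl β : ℝ)
    (w z : H10 Ω) : Prop :=
  ∀ v : H10 Ω, diffusion (fun x => β • (1 : Matrix (Fin d) (Fin d) ℝ) + A x) z v =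
    (β + αspl) * dirichlet w v

/-- `(u_n)` is a sequence of iterates of the damped splitting scheme (with any `u₀`, `u₁`). -/
def IsDampedSplitting {d : ℕ} {Ω : Set (E d)} (A : E d → Matrix (Fin d) (Fin d) ℝ)
    (b : E d → E d) (f : E d → ℝ) (αspl β : ℝ) (u : ℕ → H10 Ω) : Prop :=
  ∀ n : ℕ, IsConvectionStep b f αspl β (u (2 * n)) (u (2 * n + 1)) (u (2 * n + 2)) ∧
    IsDiffusionStep A αspl β (u (2 * n + 2)) (u (2 * n + 3))

/-- The contraction factor as a function of the damping parameter `x`: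
`C ‖b‖ / (x + αspl) · ‖A - αspl Id‖ / (x + α₁) + x / (x + α₁)`. -/
def factor {d : ℕ} (Ω : Set (E d)) (A : E d → Matrix (Fin d) (Fin d) ℝ) (b : E d → E d)
    (C αspl α₁ x : ℝ) : ℝ :=
  C * supNorm Ω b / (x + αspl) *
      (supNorm Ω (fun y => op (A y - αspl • (1 : Matrix (Fin d) (Fin d) ℝ))) / (x + α₁)) +
    x / (x + α₁)

/-- `β` is a minimizer of `g` over `[0, ∞)`. -/
def IsArgminNonneg (g : ℝ → ℝ) (β : ℝ) : Prop := 0 ≤ β ∧ IsMinOn g (Set.Ici 0) β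

end

end DampedSplitting

open DampedSplitting

/-! Everything rests on three energy estimates. Write `w`, `z`, `w'` for differences of consecutive
iterates, so that the load `f` drops out. Testing the diffusion step with `z` gives `(β + α₁)|z| ≤
(β + αspl)|w|`; testing it with `w - z` gives `(β + α₁)|w - z| ≤ ‖A - αspl Id‖ |w|`. Since `div b =
0`, the convection form vanishes on the diagonal, and testing the convection step with `w'` gives
`(β + αspl)|w'| ≤ C‖b‖ |w - z| + β|z|`. Together, `|w'| ≤ g(β)|w|` (`contraction_step`).

The weak solution, paired with a suitable auxiliary function, is a fixed point of the scheme
(`exists_fixed_point`), so the same contraction applied to the errors gives convergence once `g(β) <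
1`. That, and uniqueness of the minimizer, come from reading `g(x) - m` as a quadratic over a
positive denominator (`existsUnique_isArgminNonneg`). Well-posedness of each step is Lax–Milgram. -/

theorem real_inner_eq_mul (a b : ℝ) : inner ℝ a b = a * b := by simp [mul_comm]

/-! ### Multiplication operators on `L²` -/

theorem exists_multiplication_operator {α F F' : Type*} [MeasurableSpace α] {μ : Measure α}
    [NormedAddCommGroup F] [NormedSpace ℝ F] [NormedAddCommGroup F'] [NormedSpace ℝ F']
    {T : α → F →L[ℝ] F'} (hT : MemLp T ⊤ μ) :
    ∃ L : Lp F 2 μ →L[ℝ] Lp F' 2 μ, (∀ G, L G =ᵐ[μ] fun x => T x (G x)) ∧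
      ∀ G, ‖L G‖ ≤ (eLpNorm T ⊤ μ).toReal * ‖G‖ := by
  have hbound : ∀ᵐ x ∂μ, ‖T x‖ ≤ (eLpNorm T ⊤ μ).toReal := by
    have h := hT.eLpNorm_ne_top
    rw [eLpNorm_exponent_top] at h ⊢
    filter_upwards [ae_le_eLpNormEssSup (f := T) (μ := μ)] with x hx
    simpa using ENNReal.toReal_mono h hx
  have hbd : ∀ G : Lp F 2 μ, ∀ᵐ x ∂μ, ‖T x (G x)‖ ≤ (eLpNorm T ⊤ μ).toReal * ‖G x‖ := fun G => by
    filter_upwards [hbound] with x hx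
    exact ((T x).le_opNorm _).trans (mul_le_mul_of_nonneg_right hx (norm_nonneg _))
  have hmem : ∀ G : Lp F 2 μ, MemLp (fun x => T x (G x)) 2 μ := fun G =>
    (Lp.memLp G).of_le_mul ((ContinuousLinearMap.id ℝ (F →L[ℝ] F')).aestronglyMeasurable_comp₂
      hT.1 (Lp.aestronglyMeasurable G)) (hbd G)
  let L₀ : Lp F 2 μ →ₗ[ℝ] Lp F' 2 μ :=
    { toFun := fun G => (hmem G).toLp
      map_add' := fun G H => by
        apply Lp.ext
        filter_upwards [(hmem (G + H)).coeFn_toLp, (hmem G).coeFn_toLp, (hmem H).coeFn_toLp,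
          Lp.coeFn_add (hmem G).toLp (hmem H).toLp, Lp.coeFn_add G H] with x h1 h2 h3 h4 h5
        rw [h1, h4, Pi.add_apply, h2, h3, h5, Pi.add_apply, map_add]
      map_smul' := fun c G => by
        apply Lp.ext
        filter_upwards [(hmem (c • G)).coeFn_toLp, (hmem G).coeFn_toLp,
          Lp.coeFn_smul c (hmem G).toLp, Lp.coeFn_smul c G] with x h1 h2 h3 h4
        rw [h1, RingHom.id_apply, h3, Pi.smul_apply, h2, h4, Pi.smul_apply, map_smul] }
  have hL₀ : ∀ G, ‖L₀ G‖ ≤ (eLpNorm T ⊤ μ).toReal * ‖G‖ := fun G => by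
    apply Lp.norm_le_mul_norm_of_ae_le_mul
    filter_upwards [(hmem G).coeFn_toLp, hbd G] with x h1 h2
    exact (congrArg norm h1).trans_le h2
  exact ⟨L₀.mkContinuous _ hL₀, fun G => (hmem G).coeFn_toLp, hL₀⟩

/-- Expanding in matrix units reduces measurability and boundedness of `x ↦ op (A x)` to those of
the entries. -/
theorem op_eq_sum {d : ℕ} (M : Matrix (Fin d) (Fin d) ℝ) :
    op M = ∑ i, ∑ j, M i j • op (Matrix.single i j (1 : ℝ)) := by
  conv_lhs => rw [Matrix.matrix_eq_sum_single M]
  simp only [op, map_sum]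
  refine Finset.sum_congr rfl fun i _ => Finset.sum_congr rfl fun j _ => ?_
  rw [← map_smul, Matrix.smul_single, smul_eq_mul, mul_one]

theorem memLp_sum_sum_smul_const {α ι F : Type*} [Fintype ι] [MeasurableSpace α] {μ : Measure α}
    [NormedAddCommGroup F] [NormedSpace ℝ F] {p : ENNReal} {a : ι → ι → α → ℝ}
    (ha : ∀ i j, MemLp (a i j) p μ) (c : ι → ι → F) :
    MemLp (fun x => ∑ i, ∑ j, a i j x • c i j) p μ := by
  refine memLp_finsetSum _ fun i _ => memLp_finsetSum _ fun j _ => ?_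
  exact (ContinuousLinearMap.smulRight (1 : ℝ →L[ℝ] ℝ) (c i j)).comp_memLp' (ha i j)

theorem memLp_op {d : ℕ} {μ : Measure (E d)} {A : E d → Matrix (Fin d) (Fin d) ℝ}
    (hA : ∀ i j, MemLp (fun x => A x i j) ⊤ μ) : MemLp (fun x => op (A x)) ⊤ μ := by
  simp_rw [op_eq_sum (A _)]
  exact memLp_sum_sum_smul_const hA _

/-- In `IsElliptic` the null set may depend on `ξ`. A countable dense set of `ξ` gives one null set,
and continuity in `ξ` covers the rest. -/
theorem DampedSplitting.IsElliptic.ae_forall {d : ℕ} {Ω : Set (E d)}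
    {A : E d → Matrix (Fin d) (Fin d) ℝ}
    {α₁ α₂ : ℝ} (h : IsElliptic Ω A α₁ α₂) :
    ∀ᵐ x ∂(volume.restrict Ω), ∀ ξ : E d, α₁ * ‖ξ‖ ^ 2 ≤ inner ℝ (op (A x) ξ) ξ := by
  have h' := ae_all_iff.2 fun n : ℕ => h (TopologicalSpace.denseSeq (E d) n)
  filter_upwards [h'] with x hx ξ
  refine (TopologicalSpace.denseRange_denseSeq (E d)).induction_on
    (p := fun ξ => α₁ * ‖ξ‖ ^ 2 ≤ inner ℝ (op (A x) ξ) ξ) ξ ?_ fun n => (hx n).1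
  exact isClosed_le (by fun_prop) (by fun_prop)

/-! ### The space `H¹₀(Ω)` -/

noncomputable section

variable {d : ℕ} {Ω : Set (E d)}

instance : CompleteSpace (H10 Ω) :=
  (Submodule.isClosed_topologicalClosure (testPairs Ω)).completeSpace_coe

/-- The function of an element of `H¹₀(Ω)`, as a continuous linear map. -/
def fnL (Ω : Set (E d)) : H10 Ω →L[ℝ] Lp ℝ 2 (volume.restrict Ω) :=
  (WithLp.fstL 2 ℝ _ _).comp (H10 Ω).subtypeL

/-- The weak gradient, as a continuous linear map. -/
def gradL (Ω : Set (E d)) : H10 Ω →L[ℝ] Lp (E d) 2 (volume.restrict Ω) :=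
  (WithLp.sndL 2 ℝ _ _).comp (H10 Ω).subtypeL

@[simp] theorem fnL_apply (u : H10 Ω) : fnL Ω u = fn u := rfl

@[simp] theorem gradL_apply (u : H10 Ω) : gradL Ω u = grad u := rfl

theorem norm_sq_eq (u : H10 Ω) : ‖u‖ ^ 2 = ‖fn u‖ ^ 2 + ‖grad u‖ ^ 2 :=
  WithLp.prod_norm_sq_eq_of_L2 (u : L2Pair Ω)

theorem H10.induction_on {P : H10 Ω → Prop} (hP : IsClosed {u | P u})
    (h : ∀ u : H10 Ω, (u : L2Pair Ω) ∈ testPairs Ω → P u) (u : H10 Ω) : P u := by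
  have hd : Dense {u : H10 Ω | (u : L2Pair Ω) ∈ testPairs Ω} := by
    rw [Subtype.dense_iff]
    intro p hp
    refine closure_mono (fun q hq => ?_) hp
    exact ⟨⟨q, Submodule.le_topologicalClosure _ hq⟩, hq, rfl⟩
  exact closure_minimal (t := {u | P u}) h hP (hd u)

/-- This makes the gradient seminorm control the `H¹` norm, which yields both coercivity and
convergence in `H¹`. -/
theorem norm_le_of_isPoincareConstant {C : ℝ} (hC : IsPoincareConstant Ω C) (u : H10 Ω) :
    ‖u‖ ≤ (C + 1) * ‖grad u‖ := by
  have h := hC.2 u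
  have := hC.1
  refine abs_le_of_sq_le_sq' ?_ (by positivity) |>.2
  rw [norm_sq_eq]
  nlinarith [norm_nonneg (fn u), norm_nonneg (grad u), mul_nonneg hC.1 (sq_nonneg ‖grad u‖),
    pow_le_pow_left₀ (norm_nonneg _) h 2]

/-! ### Test functions -/

theorem DampedSplitting.IsTestFunction.mul {φ ψ : E d → ℝ} (hφ : IsTestFunction Ω φ)
    (hψ : IsTestFunction Ω ψ) : IsTestFunction Ω (φ * ψ) :=
  ⟨hφ.1.mul hψ.1, hφ.2.1.mul_right,
    (closure_mono (Function.support_mul_subset_left φ ψ)).trans hφ.2.2⟩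

theorem DampedSplitting.IsTestFunction.inner_gradient_sq {φ : E d → ℝ} (hφ : IsTestFunction Ω φ)
    (x v : E d) : inner ℝ v (gradient (φ * φ) x) = 2 * (inner ℝ v (gradient φ x) * φ x) := by
  have h : DifferentiableAt ℝ φ x := (hφ.1.differentiable (by simp)) x
  have h1 : inner ℝ v (gradient (φ * φ) x) = fderiv ℝ (φ * φ) x v := by
    rw [real_inner_comm]; simp [gradient]
  have h2 : inner ℝ v (gradient φ x) = fderiv ℝ φ x v := by
    rw [real_inner_comm]; simp [gradient]
  rw [h1, h2, fderiv_mul h h]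
  simp; ring

/-- Integrate `φ² · ∂ᵢxᵢ` by parts along one coordinate, on which `|xᵢ| ≤ R`, and absorb half of `∫
φ²` by Young's inequality. Positivity of `d` supplies the coordinate. -/
theorem poincare_test {φ : E d → ℝ} (hφ : IsTestFunction Ω φ) (hd : 0 < d) {R : ℝ} (hR : 0 ≤ R)
    (hΩ : ∀ x ∈ Ω, ‖x‖ ≤ R) :
    ∫ x in Ω, φ x ^ 2 ≤ (2 * R) ^ 2 * ∫ x in Ω, ‖gradient φ x‖ ^ 2 := by
  set i : Fin d := ⟨0, hd⟩
  set e : E d := EuclideanSpace.single i 1 with he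
  have hne : ‖e‖ = 1 := by simp [he]
  have hdiff := hφ.1.differentiable (by simp)
  have hgrad : ∀ x, ‖gradient φ x‖ = ‖fderiv ℝ φ x‖ := fun x => by simp [gradient]
  have hφ0 : ∀ x ∉ Ω, φ x = 0 := fun x hx => image_eq_zero_of_notMem_tsupport fun h => hx (hφ.2.2 h)
  have hg0 : ∀ x ∉ Ω, fderiv ℝ φ x = 0 := fun x hx =>
    image_eq_zero_of_notMem_tsupport fun h => hx (hφ.2.2 (tsupport_fderiv_subset ℝ h))
  have hcf : Continuous (fderiv ℝ φ) := hφ.1.continuous_fderiv (by simp)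
  have hcφ := hφ.1.continuous
  have hsf : HasCompactSupport (fderiv ℝ φ) := hφ.2.1.fderiv ℝ
  rw [setIntegral_eq_integral_of_forall_compl_eq_zero (fun x hx => by rw [hφ0 x hx]; simp),
    setIntegral_eq_integral_of_forall_compl_eq_zero (fun x hx => by rw [hgrad, hg0 x hx]; simp)]
  simp only [hgrad]
  have hsφ : HasCompactSupport φ := hφ.2.1
  let p : E d →L[ℝ] ℝ := EuclideanSpace.proj i
  have hfd : ∀ x, fderiv ℝ (fun x => φ x ^ 2) x e = 2 * φ x * fderiv ℝ φ x e := fun x => by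
    rw [fderiv_fun_pow _ (hdiff x)]; simp
  have hcs2 : HasCompactSupport fun x => φ x ^ 2 :=
    hsφ.comp_left (g := fun t : ℝ => t ^ 2) (by simp)
  have hcs3 : HasCompactSupport fun x => ‖fderiv ℝ φ x‖ ^ 2 :=
    hsf.comp_left (g := fun t => ‖t‖ ^ 2) (by simp)
  have i2 : Integrable (fun x => φ x ^ 2) (volume : Measure (E d)) :=
    (by fun_prop : Continuous fun x => φ x ^ 2).integrable_of_hasCompactSupport hcs2
  have i3 : Integrable (fun x => ‖fderiv ℝ φ x‖ ^ 2) (volume : Measure (E d)) :=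
    (by fun_prop : Continuous fun x => ‖fderiv ℝ φ x‖ ^ 2).integrable_of_hasCompactSupport hcs3
  have i4 : Integrable (fun x => 2 * φ x * fderiv ℝ φ x e * p x) (volume : Measure (E d)) := by
    apply (by fun_prop : Continuous _).integrable_of_hasCompactSupport
    exact HasCompactSupport.mono hsφ fun x hx h =>
      hx (by simp [Function.notMem_support.1 (not_not.2 h)])
  have hp : ∀ x, fderiv ℝ (fun x => p x) x e = 1 := fun x => by
    rw [show (fun x => p x) = ⇑p from rfl, p.fderiv]; simp [p, he]
  have key := integral_mul_fderiv_eq_neg_fderiv_mul_of_integrable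
    (μ := (volume : Measure (E d))) (f := fun x => φ x ^ 2) (g := fun x => p x) (v := e)
    (by simpa only [hfd] using i4) (by simpa only [hp, mul_one] using i2)
    (by
      apply (by fun_prop : Continuous _).integrable_of_hasCompactSupport
      exact hcs2.mul_right)
    (fun x _ => (hdiff x).pow 2) (fun x _ => p.differentiableAt)
  simp only [hfd, hp, mul_one] at key
  rw [← integral_neg] at key
  have hle : ∫ x, -(2 * φ x * fderiv ℝ φ x e * p x) ≤
      ∫ x, (1 / 2 * φ x ^ 2 + 2 * R ^ 2 * ‖fderiv ℝ φ x‖ ^ 2) := by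
    refine integral_mono i4.neg ((i2.const_mul _).add (i3.const_mul _)) fun x => ?_
    by_cases hx : x ∈ Ω
    · have h1 : |fderiv ℝ φ x e| ≤ ‖fderiv ℝ φ x‖ := by
        simpa [hne] using (fderiv ℝ φ x).le_opNorm e
      have h2 : |p x| ≤ R := (PiLp.norm_apply_le x i).trans (hΩ x hx)
      have h3 : (fderiv ℝ φ x e * p x) ^ 2 ≤ (R * ‖fderiv ℝ φ x‖) ^ 2 := by
        rw [← sq_abs, abs_mul, mul_comm]
        gcongr
      dsimp only
      -- With `y = xᵢ ∂ᵢφ`, this is `-2φy ≤ φ²/2 + 2y²`.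
      nlinarith [sq_nonneg (φ x + 2 * (fderiv ℝ φ x e * p x))]
    · simp only [hφ0 x hx, hg0 x hx]; simp
  rw [integral_add (i2.const_mul _) (i3.const_mul _), integral_const_mul, integral_const_mul] at hle
  nlinarith

theorem norm_sq_Lp {F : Type*} [NormedAddCommGroup F] [InnerProductSpace ℝ F] {μ : Measure (E d)}
    (G : Lp F 2 μ) {h : E d → F} (hG : G =ᵐ[μ] h) : ‖G‖ ^ 2 = ∫ x, ‖h x‖ ^ 2 ∂μ := by
  rw [← real_inner_self_eq_norm_sq, L2.inner_def]
  refine integral_congr_ae ?_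
  filter_upwards [hG] with x hx
  rw [hx, real_inner_self_eq_norm_sq]

theorem exists_isPoincareConstant (hd : 0 < d) (hΩ : Bornology.IsBounded Ω) :
    ∃ C : ℝ, IsPoincareConstant Ω C := by
  obtain ⟨R, hR, hRΩ⟩ := hΩ.exists_pos_norm_le
  refine ⟨2 * R, by positivity, fun u => ?_⟩
  refine H10.induction_on (P := fun u => ‖fn u‖ ≤ 2 * R * ‖grad u‖) ?_ ?_ u
  · exact isClosed_le (fnL Ω).continuous.norm (continuous_const.mul (gradL Ω).continuous.norm)
  · rintro v ⟨φ, hφ, h1, h2⟩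
    refine abs_le_of_sq_le_sq' ?_ (by positivity) |>.2
    rw [mul_pow, norm_sq_Lp (fn v) h1, norm_sq_Lp (grad v) h2]
    simpa using poincare_test hφ hd hR.le hRΩ

/-! ### The forms -/

theorem dirichlet_eq (u v : H10 Ω) : dirichlet u v = inner ℝ (grad u) (grad v) :=
  (L2.inner_def _ _).symm

theorem diffusion_eq {A : E d → Matrix (Fin d) (Fin d) ℝ} {u : H10 Ω}
    {G : Lp (E d) 2 (volume.restrict Ω)}
    (hG : G =ᵐ[volume.restrict Ω] fun x => op (A x) (grad u x)) (v : H10 Ω) :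
    diffusion A u v = inner ℝ G (grad v) := by
  rw [L2.inner_def]
  refine integral_congr_ae ?_
  filter_upwards [hG] with x hx
  rw [hx]

theorem exists_load_form {f : E d → ℝ} (hf : MemLp f 2 (volume.restrict Ω)) :
    ∃ F : H10 Ω →L[ℝ] ℝ, ∀ v, F v = load f v := by
  refine ⟨(innerSL ℝ hf.toLp).comp (fnL Ω), fun v => ?_⟩
  rw [ContinuousLinearMap.comp_apply, innerSL_apply_apply, L2.inner_def]
  refine integral_congr_ae ?_
  filter_upwards [hf.coeFn_toLp] with x hx
  rw [hx, real_inner_eq_mul, fnL_apply]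

/-- The diagonal vanishes because `(b · ∇φ) φ = ½ b · ∇(φ²)` and `φ²` is again a test function;
density and continuity extend this to `H¹₀`. -/
theorem exists_convection_form {b : E d → E d} (hb : MemLp b ⊤ (volume.restrict Ω))
    (hdiv : IsDivFree Ω b) :
    ∃ B : H10 Ω →L[ℝ] H10 Ω →L[ℝ] ℝ, (∀ u v, B u v = convection b u v) ∧
      (∀ u v, |B u v| ≤ supNorm Ω b * ‖grad u‖ * ‖fn v‖) ∧ ∀ u, B u u = 0 := by
  have hT : MemLp (fun x => innerSL ℝ (b x)) ⊤ (volume.restrict Ω) :=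
    (innerSL ℝ (E := E d)).comp_memLp' hb
  obtain ⟨L, hL, hLn⟩ := exists_multiplication_operator hT
  have hn : (eLpNorm (fun x => innerSL ℝ (b x)) ⊤ (volume.restrict Ω)).toReal = supNorm Ω b := by
    rw [supNorm]; congr 1
    exact eLpNorm_congr_norm_ae (Eventually.of_forall fun x => innerSL_apply_norm ..)
  rw [hn] at hLn
  let B : H10 Ω →L[ℝ] H10 Ω →L[ℝ] ℝ := (innerSL ℝ).bilinearComp (L.comp (gradL Ω)) (fnL Ω)
  have hB : ∀ u v, B u v = inner ℝ (L (grad u)) (fn v) := fun u v => rfl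
  have hBc : ∀ u v, B u v = convection b u v := fun u v => by
    rw [hB, L2.inner_def]
    refine integral_congr_ae ?_
    filter_upwards [hL (grad u)] with x hx
    rw [hx, innerSL_apply_apply, real_inner_eq_mul]
  refine ⟨B, hBc, fun u v => ?_, ?_⟩
  · rw [hB]
    exact (abs_real_inner_le_norm _ _).trans
      (mul_le_mul_of_nonneg_right (hLn _) (norm_nonneg _))
  · refine H10.induction_on (P := fun u => B u u = 0) ?_ ?_
    · exact isClosed_eq (B.continuous.clm_apply continuous_id) continuous_const
    · rintro u ⟨φ, hφ, h1, h2⟩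
      have h := hdiv _ (hφ.mul hφ)
      simp only [hφ.inner_gradient_sq] at h
      rw [integral_const_mul] at h
      rw [hBc, ← (mul_eq_zero.1 h).resolve_left two_ne_zero]
      refine integral_congr_ae ?_
      filter_upwards [h1, h2] with x hx1 hx2
      rw [show fn u x = φ x from hx1, show grad u x = gradient φ x from hx2]

end

/-! ### The contraction factor -/

theorem existsUnique_isArgminNonneg {K s a : ℝ} (hK : 0 ≤ K) (hs : 0 < s) (ha : 0 < a)
    {g : ℝ → ℝ} (hg : ∀ x, 0 ≤ x → g x = (K / (x + s) + x) / (x + a)) :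
    (∃! β, IsArgminNonneg g β) ∧ ∀ β, IsArgminNonneg g β → g β < 1 := by
  -- Clearing the positive denominators turns comparisons of `g x` with `m` into sign conditions on
  -- a quadratic with leading coefficient `1 - m`.
  have hgc : ∀ x, 0 ≤ x → ∀ m, (g x = m ↔ K + x * (x + s) - m * (x + a) * (x + s) = 0) ∧
      (m ≤ g x ↔ 0 ≤ K + x * (x + s) - m * (x + a) * (x + s)) := by
    intro x hx m
    have h1 : 0 < x + s := by linarith
    have h2 : 0 < x + a := by linarith
    have h : g x - m = (K + x * (x + s) - m * (x + a) * (x + s)) / ((x + s) * (x + a)) := by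
      rw [hg x hx]; field_simp
    constructor
    · rw [← sub_eq_zero, h, div_eq_zero_iff]
      simp [h1.ne', h2.ne']
    · rw [← sub_nonneg, h, div_nonneg_iff]
      have : 0 < (x + s) * (x + a) := by positivity
      constructor
      · rintro (h | h)
        · exact h.1
        · linarith [h.2]
      · exact fun h => Or.inl ⟨h, this.le⟩
  -- `g x < 1` means `K < a (x + s)`, which `x = K / a` satisfies since `s > 0`.
  have hx₀ : (0 : ℝ) ≤ K / a := by positivity
  have hlt : g (K / a) < 1 := by
    refine lt_of_not_ge fun h => ?_
    have := ((hgc _ hx₀ 1).2.1 h)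
    have hKa : K / a * a = K := by field_simp
    nlinarith
  have hex : ∃ β ∈ Set.Ici (0 : ℝ), IsMinOn g (Set.Ici 0) β := by
    refine ContinuousOn.exists_isMinOn' (x₀ := K / a) ?_ isClosed_Ici hx₀ ?_
    · refine ContinuousOn.congr (f := fun x => (K / (x + s) + x) / (x + a)) ?_ fun x hx => hg x hx
      have h1 : ∀ x ∈ Set.Ici (0 : ℝ), x + s ≠ 0 := fun x hx => by
        have : 0 ≤ x := hx
        linarith
      have h2 : ∀ x ∈ Set.Ici (0 : ℝ), x + a ≠ 0 := fun x hx => by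
        have : 0 ≤ x := hx
        linarith
      fun_prop (disch := assumption)
    · set m := g (K / a)
      -- Beyond this threshold `x / (x + a) ≥ m` already, so the minimum is sought on a compact
      -- interval.
      have hb : ∀ x, 0 ≤ x → m * a / (1 - m) ≤ x → m ≤ g x := by
        intro x hx hmx
        rw [div_le_iff₀ (by linarith)] at hmx
        rw [(hgc x hx m).2]
        nlinarith
      rw [eventually_inf_principal]
      filter_upwards [(isCompact_Icc (a := 0) (b := m * a / (1 - m))).compl_mem_cocompact]
        with x hx hx0
      refine hb x hx0 (le_of_not_ge fun h => hx ⟨hx0, h⟩)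
  have hmin : ∀ β, IsArgminNonneg g β → g β < 1 := fun β hβ => (hβ.2 hx₀).trans_lt hlt
  obtain ⟨β, hβ0, hβ⟩ := hex
  refine ⟨⟨β, ⟨hβ0, hβ⟩, fun γ hγ => ?_⟩, hmin⟩
  by_contra hne
  have hγ0 : 0 ≤ γ := hγ.1
  replace hβ0 : 0 ≤ β := hβ0
  have hm1 : g β < 1 := hmin β ⟨hβ0, hβ⟩
  have e1 := (hgc β hβ0 (g β)).1.1 rfl
  have e2 := (hgc γ hγ0 (g β)).1.1 (le_antisymm (hγ.2 hβ0) (hβ hγ0))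
  have hmid : (0 : ℝ) ≤ (β + γ) / 2 := by positivity
  have e3 := (hgc _ hmid (g β)).2.1 (hβ hmid)
  -- Two distinct minimizers would be roots of the quadratic, which is then negative at their
  -- midpoint: its value there is `-(1 - g β)(γ - β)² / 4`.
  have : 0 < (1 - g β) * (γ - β) ^ 2 :=
    mul_pos (by linarith) (by have := sub_ne_zero.2 hne; positivity)
  nlinarith

/-! ### Abstract existence results -/

/-- Lax–Milgram; no symmetry of `B` is needed. -/
theorem existsUnique_of_isCoercive {V : Type*} [NormedAddCommGroup V] [InnerProductSpace ℝ V]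
    [CompleteSpace V] {B : V →L[ℝ] V →L[ℝ] ℝ} (hB : IsCoercive B) (F : V →L[ℝ] ℝ) :
    ∃! u, ∀ v, B u v = F v := by
  set r := (InnerProductSpace.toDual ℝ V).symm F
  have hr : ∀ v, inner ℝ r v = F v := fun v => InnerProductSpace.toDual_symm_apply
  refine ⟨hB.continuousLinearEquivOfBilin.symm r, fun v => ?_, fun u hu => ?_⟩
  · rw [← hB.continuousLinearEquivOfBilin_apply, ContinuousLinearEquiv.apply_symm_apply, hr]
  · rw [ContinuousLinearEquiv.eq_symm_apply]
    refine ext_inner_right ℝ fun v => ?_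
    rw [hB.continuousLinearEquivOfBilin_apply, hu, hr]

/-- The recursion runs on the pairs `(u (2n), u (2n+1))`; the initial pair need not satisfy `Q`. -/
theorem existsUnique_two_step_seq {V : Type*} {P : V → V → V → Prop} {Q : V → V → Prop}
    (hP : ∀ p q, ∃! w, P p q w) (hQ : ∀ w, ∃! z, Q w z) (u₀ u₁ : V) :
    ∃! u : ℕ → V, u 0 = u₀ ∧ u 1 = u₁ ∧
      ∀ n, P (u (2 * n)) (u (2 * n + 1)) (u (2 * n + 2)) ∧ Q (u (2 * n + 2)) (u (2 * n + 3)) := by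
  choose S hS hSu using hP
  choose T hT hTu using hQ
  let p : ℕ → V × V := fun n =>
    Nat.rec (u₀, u₁) (fun _ q => (S q.1 q.2, T (S q.1 q.2))) n
  have hp : ∀ n, p (n + 1) = (S (p n).1 (p n).2, T (S (p n).1 (p n).2)) := fun n => rfl
  let u : ℕ → V := fun n => if n % 2 = 0 then (p (n / 2)).1 else (p (n / 2)).2
  have he : ∀ n, u (2 * n) = (p n).1 := fun n => by
    simp [u]
  have ho : ∀ n, u (2 * n + 1) = (p n).2 := fun n => by
    simp only [u]
    rw [if_neg (by omega), show (2 * n + 1) / 2 = n by omega]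
  refine ⟨u, ⟨he 0, ho 0, fun n => ?_⟩, ?_⟩
  · have h2 := he (n + 1)
    have h3 := ho (n + 1)
    rw [show 2 * (n + 1) = 2 * n + 2 by ring, hp] at h2 h3
    rw [he, ho, h2, h3]
    exact ⟨hS _ _, hT _⟩
  · rintro v ⟨h0, h1, hv⟩
    have key : ∀ n, v (2 * n) = u (2 * n) ∧ v (2 * n + 1) = u (2 * n + 1) := by
      intro n
      induction n with
      | zero => exact ⟨h0.trans (he 0).symm, h1.trans (ho 0).symm⟩
      | succ n ih =>
        have h2 := hSu _ _ _ (hv n).1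
        have h3 := hTu _ _ (hv n).2
        rw [ih.1, ih.2, he, ho] at h2
        rw [h2] at h3
        rw [he, ho, hp]
        exact ⟨h2, h3⟩
    ext1 n
    obtain ⟨k, rfl | rfl⟩ := Nat.even_or_odd' n
    · exact (key k).1
    · exact (key k).2

theorem le_of_mul_sq_le_mul {c m t : ℝ} (hm : 0 ≤ m) (ht : 0 ≤ t) (h : c * t ^ 2 ≤ m * t) :
    c * t ≤ m := by
  rcases ht.eq_or_lt with rfl | ht
  · simpa using hm
  · exact le_of_mul_le_mul_right (by linarith) ht

/-! ### The scheme in a Hilbert space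

The gradient is replaced by an operator `γ : V → W` controlling the norm of `V`, the diffusion by an
operator `L` of `W`, and the convection by a form `B` on `V`. -/

section Abstract

variable {V W : Type*} [NormedAddCommGroup V] [InnerProductSpace ℝ V]
  [NormedAddCommGroup W] [InnerProductSpace ℝ W]

/-- The form `(u, v) ↦ ⟪S u, T v⟫`. -/
noncomputable def innerForm (S T : V →L[ℝ] W) : V →L[ℝ] V →L[ℝ] ℝ := (innerSL ℝ).bilinearComp S T

@[simp] theorem innerForm_apply (S T : V →L[ℝ] W) (u v : V) :
    innerForm S T u v = inner ℝ (S u) (T v) := rfl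

/-- `⟪L ∇u, ∇v⟫ + B(u, v) = F v` for all `v`. -/
def WeakSolution (γ : V →L[ℝ] W) (L : W →L[ℝ] W) (B : V →L[ℝ] V →L[ℝ] ℝ) (F : V →L[ℝ] ℝ)
    (u : V) : Prop :=
  ∀ v, inner ℝ (L (γ u)) (γ v) + B u v = F v

/-- The convection step of the damped scheme. -/
def ConvectionStep (γ : V →L[ℝ] W) (B : V →L[ℝ] V →L[ℝ] ℝ) (F : V →L[ℝ] ℝ) (s β : ℝ)
    (p q w : V) : Prop :=
  ∀ v, (β + s) * inner ℝ (γ w) (γ v) + B w v = F v + B (p - q) v + β * inner ℝ (γ q) (γ v)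

/-- The diffusion step of the damped scheme. -/
def DiffusionStep (γ : V →L[ℝ] W) (L : W →L[ℝ] W) (s β : ℝ) (w z : V) : Prop :=
  ∀ v, β * inner ℝ (γ z) (γ v) + inner ℝ (L (γ z)) (γ v) = (β + s) * inner ℝ (γ w) (γ v)

variable {γ : V →L[ℝ] W} {L : W →L[ℝ] W} {B : V →L[ℝ] V →L[ℝ] ℝ} {F : V →L[ℝ] ℝ}
  {c s a β b N : ℝ}

theorem isCoercive_of_le (hγ : ∀ u, ‖u‖ ≤ c * ‖γ u‖) (hc : 0 < c) (ha : 0 < a)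
    (hB : ∀ u, a * ‖γ u‖ ^ 2 ≤ B u u) : IsCoercive B := by
  refine ⟨a / c ^ 2, by positivity, fun u => (le_trans ?_ (hB u))⟩
  have h := pow_le_pow_left₀ (norm_nonneg _) (hγ u) 2
  rw [mul_assoc, ← sq, div_mul_eq_mul_div, div_le_iff₀ (by positivity)]
  nlinarith

section Existence

variable [CompleteSpace V]

theorem existsUnique_weakSolution (hγ : ∀ u, ‖u‖ ≤ c * ‖γ u‖) (hc : 0 < c) (ha : 0 < a)
    (hL : ∀ G, a * ‖G‖ ^ 2 ≤ inner ℝ (L G) G) (hB0 : ∀ u, B u u = 0) (F : V →L[ℝ] ℝ) :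
    ∃! u, WeakSolution γ L B F u := by
  refine existsUnique_of_isCoercive (B := innerForm (L.comp γ) γ + B)
    (isCoercive_of_le hγ hc ha fun u => ?_) F
  simpa [hB0] using hL (γ u)

theorem existsUnique_convectionStep (hγ : ∀ u, ‖u‖ ≤ c * ‖γ u‖) (hc : 0 < c) (hs : 0 < s)
    (hβ : 0 ≤ β) (hB0 : ∀ u, B u u = 0) (F : V →L[ℝ] ℝ) (p q : V) :
    ∃! w, ConvectionStep γ B F s β p q w := by
  refine existsUnique_of_isCoercive (B := (β + s) • innerForm γ γ + B)
    (isCoercive_of_le hγ hc (by linarith : 0 < β + s) fun u => ?_)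
    (F + B (p - q) + β • (innerSL ℝ (γ q)).comp γ)
  simp [hB0]

theorem existsUnique_diffusionStep (hγ : ∀ u, ‖u‖ ≤ c * ‖γ u‖) (hc : 0 < c) (ha : 0 < a)
    (hL : ∀ G, a * ‖G‖ ^ 2 ≤ inner ℝ (L G) G) (hβ : 0 ≤ β) (s : ℝ) (w : V) :
    ∃! z, DiffusionStep γ L s β w z := by
  refine existsUnique_of_isCoercive
    (B := β • innerForm γ γ + innerForm (L.comp γ) γ)
    (isCoercive_of_le hγ hc ha fun u => ?_) ((β + s) • (innerSL ℝ (γ w)).comp γ)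
  have h := hL (γ u)
  have h' := mul_nonneg hβ (sq_nonneg ‖γ u‖)
  simp
  linarith

/-- Choose `w` by solving the diffusion step backwards from `u`, a Poisson problem. In the
convection step `B w` cancels, leaving the weak equation for `u`. -/
theorem exists_fixed_point (hγ : ∀ u, ‖u‖ ≤ c * ‖γ u‖) (hc : 0 < c) (hs : 0 < s)
    (hβ : 0 ≤ β) {u : V} (hu : WeakSolution γ L B F u) :
    ∃ w, DiffusionStep γ L s β w u ∧ ConvectionStep γ B F s β w u w := by
  obtain ⟨w, hw, -⟩ := existsUnique_of_isCoercive (B := (β + s) • innerForm γ γ)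
    (isCoercive_of_le hγ hc (by linarith : 0 < β + s) fun u => by simp)
    (β • (innerSL ℝ (γ u)).comp γ + (innerSL ℝ (L (γ u))).comp γ)
  have hw' : DiffusionStep γ L s β w u := fun v => (hw v).symm
  refine ⟨w, hw', fun v => ?_⟩
  rw [map_sub, sub_apply]
  linear_combination hu v - hw' v

end Existence

/-- One step of the scheme for differences of iterates contracts the gradient. -/
theorem contraction_step (hs : 0 < s) (ha : 0 < a) (hβ : 0 ≤ β) (hb : 0 ≤ b) (hN : 0 ≤ N)
    (hL : ∀ G, a * ‖G‖ ^ 2 ≤ inner ℝ (L G) G) (hLN : ∀ G, ‖L G - s • G‖ ≤ N * ‖G‖)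
    (hB : ∀ u v, |B u v| ≤ b * ‖γ u‖ * ‖γ v‖) (hB0 : ∀ u, B u u = 0) {w z w' : V}
    (hz : DiffusionStep γ L s β w z) (hw' : ConvectionStep γ B 0 s β w z w') :
    ‖γ z‖ ≤ (β + s) / (β + a) * ‖γ w‖ ∧
      ‖γ w'‖ ≤ (b / (β + s) * (N / (β + a)) + β / (β + a)) * ‖γ w‖ := by
  have hβa : 0 < β + a := by linarith
  have hβs : 0 < β + s := by linarith
  have h1 : (β + a) * ‖γ z‖ ≤ (β + s) * ‖γ w‖ := by
    refine le_of_mul_sq_le_mul (by positivity) (norm_nonneg _) ?_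
    have e := hz z
    rw [real_inner_self_eq_norm_sq] at e
    have e1 := mul_le_mul_of_nonneg_left (real_inner_le_norm (γ w) (γ z)) hβs.le
    linarith [hL (γ z)]
  -- Substituting `z = w - v` with `v = w - z`, and testing with `v`, leaves `β‖γ v‖² + ⟪L γ v, γ v⟫
  -- = ⟪(L - s) γ w, γ v⟫`.
  have h2 : (β + a) * ‖γ (w - z)‖ ≤ N * ‖γ w‖ := by
    refine le_of_mul_sq_le_mul (by positivity) (norm_nonneg _) ?_
    have e := hz (w - z)
    have hzw : γ z = γ w - γ (w - z) := by rw [map_sub]; abel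
    have e1 := real_inner_self_eq_norm_sq (γ (w - z))
    have e2 := real_inner_le_norm (L (γ w) - s • γ w) (γ (w - z))
    have e3 := mul_le_mul_of_nonneg_right (hLN (γ w)) (norm_nonneg (γ (w - z)))
    rw [hzw, map_sub L, inner_sub_left, inner_sub_left (L (γ w)), e1] at e
    rw [inner_sub_left, real_inner_smul_left] at e2
    linarith [hL (γ (w - z))]
  have h3 : (β + s) * ‖γ w'‖ ≤ b * ‖γ (w - z)‖ + β * ‖γ z‖ := by
    refine le_of_mul_sq_le_mul (by positivity) (norm_nonneg _) ?_
    -- Testing with `w'` itself removes the convection term on the left.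
    have e := hw' w'
    rw [real_inner_self_eq_norm_sq, hB0, zero_apply] at e
    have e1 := (le_abs_self _).trans (hB (w - z) w')
    have e2 := mul_le_mul_of_nonneg_left (real_inner_le_norm (γ z) (γ w')) hβ
    linarith
  have h1' : ‖γ z‖ ≤ (β + s) / (β + a) * ‖γ w‖ := by
    rw [div_mul_eq_mul_div, le_div_iff₀ hβa]; linarith
  have h2' : ‖γ (w - z)‖ ≤ N / (β + a) * ‖γ w‖ := by
    rw [div_mul_eq_mul_div, le_div_iff₀ hβa]; linarith
  refine ⟨h1', ?_⟩
  calc ‖γ w'‖ ≤ (b * ‖γ (w - z)‖ + β * ‖γ z‖) / (β + s) := by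
        rw [le_div_iff₀ hβs]; linarith
    _ ≤ (b * (N / (β + a) * ‖γ w‖) + β * ((β + s) / (β + a) * ‖γ w‖)) / (β + s) := by
        gcongr
    _ = _ := by field_simp

/-- By linearity the load cancels in the difference of two runs. The second run is either a shift of
the first or the fixed point. -/
theorem contraction_step_sub (hs : 0 < s) (ha : 0 < a) (hβ : 0 ≤ β) (hb : 0 ≤ b) (hN : 0 ≤ N)
    (hL : ∀ G, a * ‖G‖ ^ 2 ≤ inner ℝ (L G) G) (hLN : ∀ G, ‖L G - s • G‖ ≤ N * ‖G‖)
    (hB : ∀ u v, |B u v| ≤ b * ‖γ u‖ * ‖γ v‖) (hB0 : ∀ u, B u u = 0) {p q w p' q' w' : V}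
    (hq : DiffusionStep γ L s β p q) (hq' : DiffusionStep γ L s β p' q')
    (hw : ConvectionStep γ B F s β p q w) (hw' : ConvectionStep γ B F s β p' q' w') :
    ‖γ (q - q')‖ ≤ (β + s) / (β + a) * ‖γ (p - p')‖ ∧
      ‖γ (w - w')‖ ≤ (b / (β + s) * (N / (β + a)) + β / (β + a)) * ‖γ (p - p')‖ := by
  refine contraction_step hs ha hβ hb hN hL hLN hB hB0 (fun v => ?_) fun v => ?_
  · simp only [map_sub, inner_sub_left]
    linear_combination hq v - hq' v
  · have h1 := hw v
    have h2 := hw' v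
    simp only [map_sub, sub_apply, inner_sub_left, zero_apply] at h1 h2 ⊢
    linear_combination h1 - h2

/-- The even iterates contract, and the odd iterates converge to the weak solution. -/
theorem scheme_contracts_and_converges [CompleteSpace V] (hγ : ∀ u, ‖u‖ ≤ c * ‖γ u‖) (hc : 0 < c)
    (hs : 0 < s) (ha : 0 < a) (hβ : 0 ≤ β) (hb : 0 ≤ b) (hN : 0 ≤ N)
    (hL : ∀ G, a * ‖G‖ ^ 2 ≤ inner ℝ (L G) G) (hLN : ∀ G, ‖L G - s • G‖ ≤ N * ‖G‖)
    (hB : ∀ u v, |B u v| ≤ b * ‖γ u‖ * ‖γ v‖) (hB0 : ∀ u, B u u = 0) {g : ℝ}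
    (hg : g = b / (β + s) * (N / (β + a)) + β / (β + a)) (hg1 : g < 1) {u : ℕ → V}
    (hu : ∀ n, ConvectionStep γ B F s β (u (2 * n)) (u (2 * n + 1)) (u (2 * n + 2)) ∧
      DiffusionStep γ L s β (u (2 * n + 2)) (u (2 * n + 3))) :
    (∀ n : ℕ, (1 ≤ n ∨ DiffusionStep γ L s β (u 0) (u 1)) →
      ‖γ (u (2 * n + 4) - u (2 * n + 2))‖ ≤ g * ‖γ (u (2 * n + 2) - u (2 * n))‖) ∧
    ∀ uε, WeakSolution γ L B F uε → Tendsto (fun n : ℕ => u (2 * n + 1)) atTop (𝓝 uε) := by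
  have hg0 : 0 ≤ g := by rw [hg]; positivity
  refine ⟨fun n hn => ?_, fun uε huε => ?_⟩
  · have h1 : DiffusionStep γ L s β (u (2 * n)) (u (2 * n + 1)) := by
      rcases n with _ | n
      · simpa using hn
      · exact (hu n).2
    rw [hg]
    exact (contraction_step_sub hs ha hβ hb hN hL hLN hB hB0 (hu n).2 h1 (hu (n + 1)).1 (hu n).1).2
  · obtain ⟨ws, hd, hc'⟩ := exists_fixed_point hγ hc hs hβ huε
    have hstep : ∀ n, ‖γ (u (2 * n + 3) - uε)‖ ≤ (β + s) / (β + a) * ‖γ (u (2 * n + 2) - ws)‖ ∧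
        ‖γ (u (2 * (n + 1) + 2) - ws)‖ ≤ g * ‖γ (u (2 * n + 2) - ws)‖ := fun n => by
      rw [hg]
      exact contraction_step_sub hs ha hβ hb hN hL hLN hB hB0 (hu n).2 hd (hu (n + 1)).1 hc'
    -- The decay starts at `u 2`, because `u 0` and `u 1` need not be linked by a diffusion step.
    have hgeo : ∀ n, ‖γ (u (2 * n + 2) - ws)‖ ≤ g ^ n * ‖γ (u 2 - ws)‖ := fun n => by
      induction n with
      | zero => simp
      | succ n ih =>
        refine (hstep n).2.trans ((mul_le_mul_of_nonneg_left ih hg0).trans_eq ?_)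
        ring
    rw [← tendsto_add_atTop_iff_nat 1, tendsto_iff_norm_sub_tendsto_zero]
    have hlim : Tendsto (fun n : ℕ => c * ((β + s) / (β + a) * (g ^ n * ‖γ (u 2 - ws)‖)))
        atTop (𝓝 0) := by
      have h := ((tendsto_pow_atTop_nhds_zero_of_lt_one hg0 hg1).mul_const
        ‖γ (u 2 - ws)‖).const_mul ((β + s) / (β + a)) |>.const_mul c
      simpa using h
    refine squeeze_zero (fun n => norm_nonneg _) (fun n => ?_) hlim
    exact (hγ _).trans (mul_le_mul_of_nonneg_left ((hstep n).1.trans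
      (mul_le_mul_of_nonneg_left (hgeo n) (by positivity))) hc.le)

end Abstract

/-! ### The diffusion operator -/

variable {d : ℕ} {Ω : Set (E d)}

theorem exists_diffusion_operator {A : E d → Matrix (Fin d) (Fin d) ℝ}
    (hA : ∀ i j, MemLp (fun x => A x i j) ⊤ (volume.restrict Ω)) {α₁ α₂ : ℝ}
    (hell : IsElliptic Ω A α₁ α₂) (s : ℝ) :
    ∃ L : Lp (E d) 2 (volume.restrict Ω) →L[ℝ] Lp (E d) 2 (volume.restrict Ω),
      (∀ (β : ℝ) (u v : H10 Ω),
        diffusion (fun x => β • (1 : Matrix (Fin d) (Fin d) ℝ) + A x) u v =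
          β * inner ℝ (grad u) (grad v) + inner ℝ (L (grad u)) (grad v)) ∧
      (∀ G, α₁ * ‖G‖ ^ 2 ≤ inner ℝ (L G) G) ∧
      ∀ G, ‖L G - s • G‖ ≤
        supNorm Ω (fun y => op (A y - s • (1 : Matrix (Fin d) (Fin d) ℝ))) * ‖G‖ := by
  have hop : ∀ (M : Matrix (Fin d) (Fin d) ℝ) (c : ℝ) (ξ : E d),
      op (M - c • (1 : Matrix (Fin d) (Fin d) ℝ)) ξ = op M ξ - c • ξ := fun M c ξ => by
    simp [op]
  have hAs : MemLp (fun y => op (A y - s • (1 : Matrix (Fin d) (Fin d) ℝ))) ⊤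
      (volume.restrict Ω) := memLp_op fun i j => by
    simp only [Matrix.sub_apply]
    exact (hA i j).sub (memLp_top_const _)
  obtain ⟨L, hL, -⟩ := exists_multiplication_operator (memLp_op hA)
  obtain ⟨L', hL', hL'n⟩ := exists_multiplication_operator hAs
  refine ⟨L, fun β u v => ?_, fun G => ?_, fun G => ?_⟩
  · rw [← real_inner_smul_left, ← inner_add_left]
    refine diffusion_eq ?_ v
    filter_upwards [Lp.coeFn_add (β • grad u) (L (grad u)), Lp.coeFn_smul β (grad u),
      hL (grad u)] with x h1 h2 h3
    rw [h1, Pi.add_apply, h2, h3, Pi.smul_apply]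
    simp [op]
  · rw [L2.inner_def, norm_sq_Lp G (ae_eq_refl _), ← integral_const_mul]
    refine integral_mono_ae ((L2.integrable_inner G G).congr ?_ |>.const_mul _)
      (L2.integrable_inner _ _) ?_
    · exact Eventually.of_forall fun x => real_inner_self_eq_norm_sq _
    · filter_upwards [hL G, hell.ae_forall] with x h1 h2
      rw [h1]
      exact h2 _
  · have h : L G - s • G = L' G := by
      apply Lp.ext
      filter_upwards [Lp.coeFn_sub (L G) (s • G), Lp.coeFn_smul s G, hL G, hL' G] with x h1 h2 h3 h4
      rw [h1, Pi.sub_apply, h2, h3, h4, Pi.smul_apply, hop]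
    rw [h]
    exact hL'n G

/-! ### The concrete scheme as an instance of the abstract one, and the theorem -/

set_option maxHeartbeats 1000000 in
/-- The weak formulations in terms of operators satisfying the bounds of the abstract scheme. -/
theorem exists_operators {d : ℕ} {Ω : Set (E d)} {A : E d → Matrix (Fin d) (Fin d) ℝ}
    (hA : ∀ i j, MemLp (fun x => A x i j) ⊤ (volume.restrict Ω))
    {α₁ α₂ : ℝ} (hell : IsElliptic Ω A α₁ α₂)
    {b : E d → E d} (hb : MemLp b ⊤ (volume.restrict Ω)) (hdiv : IsDivFree Ω b)
    {f : E d → ℝ} (hf : MemLp f 2 (volume.restrict Ω)) (s : ℝ) :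
    ∃ (L : Lp (E d) 2 (volume.restrict Ω) →L[ℝ] Lp (E d) 2 (volume.restrict Ω))
      (B : H10 Ω →L[ℝ] H10 Ω →L[ℝ] ℝ) (F : H10 Ω →L[ℝ] ℝ),
      (∀ G, α₁ * ‖G‖ ^ 2 ≤ inner ℝ (L G) G) ∧
      (∀ G, ‖L G - s • G‖ ≤
        supNorm Ω (fun y => op (A y - s • (1 : Matrix (Fin d) (Fin d) ℝ))) * ‖G‖) ∧
      (∀ C, IsPoincareConstant Ω C →
        ∀ u v, |B u v| ≤ C * supNorm Ω b * ‖gradL Ω u‖ * ‖gradL Ω v‖) ∧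
      (∀ u, B u u = 0) ∧
      IsWeakSolution A b f = WeakSolution (gradL Ω) L B F ∧
      IsConvectionStep b f s = ConvectionStep (gradL Ω) B F s ∧
      IsDiffusionStep A s = DiffusionStep (gradL Ω) L s := by
  obtain ⟨F, hF⟩ := exists_load_form hf
  obtain ⟨B, hB, hBn, hB0⟩ := exists_convection_form hb hdiv
  obtain ⟨L, hLd, hLc, hLN⟩ := exists_diffusion_operator hA hell s
  have hb0 : 0 ≤ supNorm Ω b := ENNReal.toReal_nonneg
  have hBC : ∀ C, IsPoincareConstant Ω C →
      ∀ u v, |B u v| ≤ C * supNorm Ω b * ‖gradL Ω u‖ * ‖gradL Ω v‖ := by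
    intro C hC u v
    rw [gradL_apply, gradL_apply]
    calc |B u v| ≤ supNorm Ω b * ‖grad u‖ * ‖fn v‖ := hBn u v
      _ ≤ supNorm Ω b * ‖grad u‖ * (C * ‖grad v‖) :=
        mul_le_mul_of_nonneg_left (hC.2 v) (by positivity)
      _ = C * supNorm Ω b * ‖grad u‖ * ‖grad v‖ := by ring
  have hLd0 : ∀ u v : H10 Ω, diffusion A u v = inner ℝ (L (grad u)) (grad v) := fun u v => by
    simpa using hLd 0 u v
  have hweak : IsWeakSolution A b f = WeakSolution (gradL Ω) L B F := by
    ext u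
    simp only [IsWeakSolution, WeakSolution, hLd0, hB, hF, gradL_apply]
  have hconv : IsConvectionStep b f s = ConvectionStep (gradL Ω) B F s := by
    ext β p q w
    simp only [IsConvectionStep, ConvectionStep, dirichlet_eq, hB, hF, gradL_apply]
  have hdiff : IsDiffusionStep A s = DiffusionStep (gradL Ω) L s := by
    ext β w z
    simp only [IsDiffusionStep, DiffusionStep, hLd, dirichlet_eq, gradL_apply]
  exact ⟨L, B, F, hLc, hLN, hBC, hB0, hweak, hconv, hdiff⟩

theorem existsUnique_isArgminNonneg_factor {d : ℕ} (Ω : Set (E d))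
    (A : E d → Matrix (Fin d) (Fin d) ℝ) (b : E d → E d) {C s a : ℝ} (hC : 0 ≤ C) (hs : 0 < s)
    (ha : 0 < a) :
    (∃! β, IsArgminNonneg (factor Ω A b C s a) β) ∧
      ∀ β, IsArgminNonneg (factor Ω A b C s a) β → factor Ω A b C s a β < 1 := by
  have hN : 0 ≤ supNorm Ω (fun y => op (A y - s • (1 : Matrix (Fin d) (Fin d) ℝ))) :=
    ENNReal.toReal_nonneg
  have hb : 0 ≤ supNorm Ω b := ENNReal.toReal_nonneg
  refine existsUnique_isArgminNonneg (mul_nonneg (mul_nonneg hC hb) hN) hs ha fun x hx => ?_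
  have h1 : x + s ≠ 0 := by positivity
  have h2 : x + a ≠ 0 := by positivity
  unfold factor
  generalize supNorm Ω (fun y => op (A y - s • (1 : Matrix (Fin d) (Fin d) ℝ))) = N
  field_simp

theorem mainTheorem7 {d : ℕ} (hd : 0 < d) (Ω : Set (E d)) (hΩ : IsOpen Ω)
    (hΩb : Bornology.IsBounded Ω)
    (A : E d → Matrix (Fin d) (Fin d) ℝ)
    (hA : ∀ i j, MemLp (fun x => A x i j) ⊤ (volume.restrict Ω))
    (α₁ α₂ : ℝ) (hα₁ : 0 < α₁) (hα₂ : α₁ ≤ α₂) (hell : IsElliptic Ω A α₁ α₂)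
    (b : E d → E d) (hb : MemLp b ⊤ (volume.restrict Ω)) (hdiv : IsDivFree Ω b)
    (f : E d → ℝ) (hf : MemLp f 2 (volume.restrict Ω))
    (αspl : ℝ) (hαspl : 0 < αspl) :
    (∃! uε : H10 Ω, IsWeakSolution A b f uε) ∧
    (∃ C : ℝ, IsPoincareConstant Ω C) ∧
    ∀ C : ℝ, IsPoincareConstant Ω C →
      (∃! β : ℝ, IsArgminNonneg (factor Ω A b C αspl α₁) β) ∧
      ∀ β : ℝ, IsArgminNonneg (factor Ω A b C αspl α₁) β →
        factor Ω A b C αspl α₁ β < 1 ∧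
        (∀ u₀ u₁ : H10 Ω, ∃! u : ℕ → H10 Ω,
          u 0 = u₀ ∧ u 1 = u₁ ∧ IsDampedSplitting A b f αspl β u) ∧
        ∀ u : ℕ → H10 Ω, IsDampedSplitting A b f αspl β u →
          (∀ n : ℕ, (1 ≤ n ∨ IsDiffusionStep A αspl β (u 0) (u 1)) →
            ‖grad (u (2 * n + 4) - u (2 * n + 2))‖ ≤
              factor Ω A b C αspl α₁ β * ‖grad (u (2 * n + 2) - u (2 * n))‖) ∧
          ∀ uε : H10 Ω, IsWeakSolution A b f uε →
            Tendsto (fun n : ℕ => u (2 * n + 1)) atTop (𝓝 uε) := by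
  obtain ⟨C₀, hC₀⟩ := exists_isPoincareConstant hd hΩb
  obtain ⟨L, B, F, hLc, hLN, hB, hB0, hweak, hconv, hdiff⟩ :=
    exists_operators hA hell hb hdiv hf αspl
  simp only [IsDampedSplitting, hweak, hconv, hdiff]
  -- The fixed constant `C₀` serves coercivity and the passage to the `H¹` norm; the arbitrary `C`
  -- enters only the contraction factor.
  have hγ := norm_le_of_isPoincareConstant hC₀
  have hc : 0 < C₀ + 1 := by linarith [hC₀.1]
  refine ⟨existsUnique_weakSolution hγ hc hα₁ hLc hB0 F, ⟨C₀, hC₀⟩, fun C hC => ?_⟩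
  obtain ⟨hex, hlt⟩ := existsUnique_isArgminNonneg_factor Ω A b hC.1 hαspl hα₁
  refine ⟨hex, fun β hβ => ⟨hlt β hβ, fun u₀ u₁ => ?_, fun u hu => ?_⟩⟩
  · exact existsUnique_two_step_seq (existsUnique_convectionStep hγ hc hαspl hβ.1 hB0 F)
      (existsUnique_diffusionStep hγ hc hα₁ hLc hβ.1 αspl) u₀ u₁
  · exact scheme_contracts_and_converges hγ hc hαspl hα₁ hβ.1
      (mul_nonneg hC.1 ENNReal.toReal_nonneg) ENNReal.toReal_nonneg hLc hLN (hB C hC) hB0 rfl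
      (hlt β hβ) hu
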